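/- **Proposition.** Let $G=(V,E)$ be a finite plane cubic (i.e. $3$-regular) graph; loops and multiple edges are allowed, $G$ need not be connected, and the embedding is described by its vertex rotations, i.e. the clockwise cyclic order of the three half-edges around each vertex. Let $F(G;x)=\sum_{A\subseteq E}(-1)^{|E|-|A|}x^{|A|-r(A)}$ be the flow polynomial of $G$, where $r(A)=|V|-k(A)$ and $k(A)$ is the number of connected components of $(V,A)$. Then $3$ divides $|E|$; for every abelian group $Q$ of order $4$, $F(G;4)$ is the number of nowhere-zero $Q$-flows of $G$; and $$(-4)^{|E|/3}\,F(G;4)=\#\{\text{even proper edge 4-colourings of }G\}-\#\{\text{odd proper edge 4-colourings of }G\}.$$ Here a proper edge $4$-colouring of $G$ assigns to each edge a colour in $\{0,1,2,3\}$ so that the three half-edges at every vertex receive distinct colours (so there is none if $G$ has a loop). At each vertex the three colours, read clockwise around the vertex, appear either in clockwise order, i.e. consistently with the cyclic order $(0\;1\;2\;3)$, or in anticlockwise order, i.e. consistently with the reverse cyclic order $(3\;2\;1\;0)$. The colouring is even (odd) if the number of vertices at which the colours appear in anticlockwise order is even (odd). -/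

import Mathlib

open Polynomial

/-- A graph with vertex set `V` and edge set `E`, in which loops and parallel edges are allowed,
presented together with a reference orientation: the edge `e` has endpoints `tail e` and `head e`
and is directed from the former to the latter. -/
structure MGraph (V E : Type*) where
  tail : E → V
  head : E → V

namespace MGraph

variable {V E : Type*}

/-- Every edge `e` has two half-edges: `(e, false)`, at its tail, and `(e, true)`, at its head.
`G.vert h` is the vertex at which the half-edge `h` sits. (A loop has two half-edges at the same
vertex.) -/
def vert (G : MGraph V E) (h : E × Bool) : V :=
  if h.2 then G.head h.1 else G.tail h.1

/-- The degree of a vertex is its number of half-edges, so that loops count twice. -/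
noncomputable def degree (G : MGraph V E) (v : V) : ℕ :=
  Nat.card {h : E × Bool // G.vert h = v}

/-- A cubic graph is a `3`-regular graph. -/
def IsCubic (G : MGraph V E) : Prop :=
  ∀ v, G.degree v = 3

/-- The number `k(A)` of connected components of the spanning subgraph `(V, A)`. -/
noncomputable def numComponents (G : MGraph V E) (A : Set E) : ℕ :=
  Nat.card (Quot fun u v : V => ∃ e ∈ A, G.tail e = u ∧ G.head e = v)

/-! ### Flows and the flow polynomial -/

/-- The rank `r(A) = |V| - k(A)` of the spanning subgraph `(V, A)`. -/
noncomputable def rank (G : MGraph V E) [Fintype V] (A : Set E) : ℕ :=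
  Fintype.card V - G.numComponents A

/-- The flow polynomial `F(G; X) = ∑_{A ⊆ E} (-1)^{|E| - |A|} X^{|A| - r(A)}`. -/
noncomputable def flowPolynomial (G : MGraph V E) [Fintype V] [Fintype E] : ℤ[X] :=
  ∑ A : Finset E, (-1) ^ (Fintype.card E - A.card) * X ^ (A.card - G.rank (A : Set E))

open Classical in
/-- The boundary of `y : E → Q` at a vertex `v`: the total value entering `v` minus the total
value leaving `v`. -/
noncomputable def boundary (G : MGraph V E) [Fintype E] {Q : Type*} [AddCommGroup Q]
    (y : E → Q) (v : V) : Q :=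
  (∑ e with G.head e = v, y e) - ∑ e with G.tail e = v, y e

/-- `y` is a nowhere-zero `Q`-flow: its boundary vanishes and it never takes the value `0`. -/
def IsNowhereZeroFlow (G : MGraph V E) [Fintype E] {Q : Type*} [AddCommGroup Q]
    (y : E → Q) : Prop :=
  (∀ v, G.boundary y v = 0) ∧ ∀ e, y e ≠ 0

/-! ### Embeddings -/

/-- An embedding of `G` in an orientable surface, given by its vertex rotations: `rot h` is the
half-edge that follows `h` in the clockwise order around the vertex of `h`, so that the cycles of
`rot` are exactly the sets of half-edges at the vertices. -/
structure Embedding (G : MGraph V E) where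
  rot : Equiv.Perm (E × Bool)
  vert_rot : ∀ h, G.vert (rot h) = G.vert h
  sameCycle : ∀ h h', G.vert h = G.vert h' → rot.SameCycle h h'

/-- The involution exchanging the two half-edges of every edge. -/
def flip (E : Type*) : Equiv.Perm (E × Bool) :=
  (Equiv.refl E).prodCongr Equiv.boolNot

/-- The face-tracing permutation: cross to the other end of the edge, then turn to the next
half-edge there. Its cycles are the boundary walks of the faces of the embedding. -/
def Embedding.face {G : MGraph V E} (M : G.Embedding) : Equiv.Perm (E × Bool) :=
  M.rot * flip E

/-- The number of face boundary walks of an embedding (of a graph without isolated vertices). -/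
noncomputable def Embedding.numFaces {G : MGraph V E} (M : G.Embedding) : ℕ :=
  Nat.card (Quotient (Equiv.Perm.SameCycle.setoid M.face))

/-- The embedding is a plane one, i.e. every connected component is embedded with genus `0`.
With faces traced separately for every component, one has `|V| - |E| + |faces| = 2k(G) - 2g` where
`g` is the sum of the genera of the components, so that this is Euler's formula. (It is used here
for graphs without isolated vertices, such as cubic graphs.) -/
def Embedding.IsPlane {G : MGraph V E} [Fintype V] [Fintype E] (M : G.Embedding) : Prop :=
  (Fintype.card V : ℤ) - Fintype.card E + M.numFaces = 2 * G.numComponents Set.univ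

/-! ### Edge colourings -/

/-- A proper edge `4`-colouring: different half-edges at the same vertex have different colours.
(In particular a graph with a loop has no proper edge colouring.) -/
def IsProperEdgeColouring (G : MGraph V E) (y : E → Fin 4) : Prop :=
  ∀ h h' : E × Bool, h ≠ h' → G.vert h = G.vert h' → y h.1 ≠ y h'.1

/-- The three colours at the vertex `v` of a cubic graph appear in an anticlockwise order: read
clockwise around `v`, starting at some half-edge `h`, they are `a, b, c` where `c, b, a` is
consistent with the cyclic order `(0 1 2 3)`, i.e. `c < b < a` or `b < a < c` or `a < c < b`. -/
def Embedding.IsAnticlockwiseAt {G : MGraph V E} (M : G.Embedding) (y : E → Fin 4) (v : V) :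
    Prop :=
  ∃ h, G.vert h = v ∧ sbtw (y (M.rot (M.rot h)).1) (y (M.rot h).1) (y h.1)

/-- The number of vertices at which the colours appear in an anticlockwise order. -/
noncomputable def Embedding.numAnticlockwise {G : MGraph V E} (M : G.Embedding)
    (y : E → Fin 4) : ℕ :=
  Nat.card {v : V // M.IsAnticlockwiseAt y v}

/-- The number of even proper edge `4`-colourings. -/
noncomputable def Embedding.numEven {G : MGraph V E} (M : G.Embedding) : ℕ :=
  Nat.card {y : E → Fin 4 // G.IsProperEdgeColouring y ∧ Even (M.numAnticlockwise y)}

/-- The number of odd proper edge `4`-colourings. -/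
noncomputable def Embedding.numOdd {G : MGraph V E} (M : G.Embedding) : ℕ :=
  Nat.card {y : E → Fin 4 // G.IsProperEdgeColouring y ∧ Odd (M.numAnticlockwise y)}

end MGraph

namespace MGraph
variable {V E : Type*}

/-! Both sides of the signed identity are reduced to the number of proper edge 3-colourings (Tait
colourings). Write |V| = 2n and |E| = 3n.

Inclusion–exclusion makes F(G;4) the number of nowhere-zero Q-flows for any Q of order 4
(`eval_flowPolynomial`). For the Klein group these are the Tait colourings (`card_isTait`).

On the other side, twice the sign of three colours at a vertex is the 3×3 determinant with rows 1,
cos, sin at the angles aπ/2 (`two_mul_colourSign`). Expanding all determinants and summing over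
4-colourings, orthogonality of the rows kills every term whose row labels differ at the two ends of
an edge. What survives is a sum over edge labellings by three rows, weighted by Levi-Civita signs
and squared norms (`two_pow_mul_sum_colourSign`); only Tait colourings contribute. Each has norm
product 16^n and, by planarity, sign product (-1)^n (`IsTait.prod_leviCivita`). Dividing (-16)^n by
2^|V| = 4^n leaves (-4)^n.

Planarity enters only through `range_faceDiff`: every mod 2 cycle is the boundary of a 2-colouring
of the faces. -/

theorem _root_.AddMonoidHom.card_ker_mul_card_range {A B : Type*} [AddGroup A] [AddGroup B]
    (f : A →+ B) : Nat.card f.ker * Nat.card f.range = Nat.card A := by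
  rw [← AddSubgroup.index_ker, AddSubgroup.card_mul_index]

/-! ### Counting flows, and the flow polynomial. -/

section Flows

variable (G : MGraph V E) {Q : Type*} [AddCommGroup Q]

/-- The connected components of `G`. -/
abbrev Component : Type _ := Quot fun u v : V => ∃ e, G.tail e = u ∧ G.head e = v

theorem numComponents_univ : G.numComponents Set.univ = Nat.card G.Component := by
  simp [numComponents, Component]

theorem component_head (e : E) :
    (Quot.mk _ (G.head e) : G.Component) = Quot.mk _ (G.tail e) :=
  (Quot.sound ⟨e, rfl, rfl⟩).symm

/-- The boundary as a homomorphism. -/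
noncomputable def boundaryHom [Fintype E] : (E → Q) →+ (V → Q) where
  toFun y v := G.boundary y v
  map_zero' := by ext v; simp [boundary]
  map_add' y z := by
    ext v
    simp only [boundary, Pi.add_apply, Finset.sum_add_distrib]
    abel

open Classical in
/-- The homomorphism summing a function on the vertices over every component. -/
noncomputable def componentSum [Fintype V] : (V → Q) →+ (G.Component → Q) where
  toFun g c := ∑ v with (Quot.mk _ v : G.Component) = c, g v
  map_zero' := by ext v; simp
  map_add' y z := by ext v; simp [Finset.sum_add_distrib]

open Classical in
theorem boundaryHom_single [Fintype E] (e : E) (x : Q) :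
    G.boundaryHom (Pi.single e x) = Pi.single (G.head e) x - Pi.single (G.tail e) x := by
  ext v
  have key : ∀ p : E → V, (∑ e' with p e' = v, (Pi.single e x : E → Q) e') =
      (Pi.single (p e) x : V → Q) v := by
    intro p
    rw [Finset.sum_filter, Finset.sum_eq_single e]
    · simp [Pi.single_apply, eq_comm]
    · intro b _ hb
      simp [hb]
    · simp
  exact congrArg₂ (· - ·) (key G.head) (key G.tail)

open Classical in
theorem boundaryHom_eq_sum [Fintype E] (y : E → Q) :
    G.boundaryHom y = ∑ e, (Pi.single (G.head e) (y e) - Pi.single (G.tail e) (y e)) := by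
  conv_lhs => rw [← Finset.univ_sum_single y]
  rw [map_sum]
  simp_rw [boundaryHom_single]

open Classical in
theorem componentSum_single [Fintype V] (v : V) (x : Q) :
    G.componentSum (Pi.single v x) = Pi.single (Quot.mk _ v) x := by
  ext c
  simp only [componentSum, AddMonoidHom.coe_mk, ZeroHom.coe_mk]
  rw [Finset.sum_filter, Finset.sum_eq_single v]
  · simp [Pi.single_apply, eq_comm]
  · intro b _ hb
    simp [hb]
  · simp

theorem componentSum_boundaryHom [Fintype V] [Fintype E] (y : E → Q) :
    G.componentSum (G.boundaryHom y) = 0 := by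
  classical
  simp [boundaryHom_eq_sum, map_sum, componentSum_single, component_head]

-- Telescope along a path from `u` to `v`; each edge contributes the boundary of a one-edge
-- function.
open Classical in
theorem single_sub_single_mem_range [Fintype E] {u v : V}
    (h : (Quot.mk _ u : G.Component) = Quot.mk _ v) (x : Q) :
    (Pi.single u x - Pi.single v x : V → Q) ∈ (G.boundaryHom (Q := Q)).range := by
  induction Quot.eqvGen_exact h with
  | rel a b hab =>
    obtain ⟨e, rfl, rfl⟩ := hab
    refine ⟨Pi.single e (-x), ?_⟩
    rw [boundaryHom_single]
    simp only [Pi.single_neg]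
    abel
  | refl a => simp [zero_mem]
  | symm a b hab ih =>
    rw [← neg_sub]
    exact neg_mem (ih (Quot.eqvGen_sound hab))
  | trans a b c hab hbc ih1 ih2 =>
    rw [← sub_add_sub_cancel _ (Pi.single b x) _]
    exact add_mem (ih1 (Quot.eqvGen_sound hab)) (ih2 (Quot.eqvGen_sound hbc))

theorem range_boundaryHom [Fintype V] [Fintype E] :
    (G.boundaryHom (Q := Q)).range = (G.componentSum (Q := Q)).ker := by
  classical
  apply le_antisymm
  · rintro _ ⟨y, rfl⟩
    exact G.componentSum_boundaryHom y
  · intro g hg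
    have := Fintype.ofFinite G.Component
    have key : g = ∑ v, (Pi.single v (g v) -
        Pi.single (Quot.out (Quot.mk _ v : G.Component)) (g v)) +
        ∑ c : G.Component, Pi.single c.out (G.componentSum g c) := by
      have h2 : ∑ c : G.Component, (Pi.single c.out (G.componentSum g c) : V → Q) =
          ∑ v, Pi.single (Quot.out (Quot.mk _ v : G.Component)) (g v) := by
        rw [← Finset.sum_fiberwise Finset.univ (fun v => (Quot.mk _ v : G.Component))]
        refine Finset.sum_congr rfl fun c _ => ?_
        have : ∀ v ∈ Finset.univ.filter (fun v => (Quot.mk _ v : G.Component) = c),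
            (Pi.single (Quot.out (Quot.mk _ v : G.Component)) (g v) : V → Q) =
              AddMonoidHom.single (fun _ => Q) c.out (g v) := by
          intro v hv
          rw [(Finset.mem_filter.1 hv).2]
          rfl
        rw [Finset.sum_congr rfl this, ← map_sum]
        rfl
      rw [h2, Finset.sum_sub_distrib, Finset.univ_sum_single, sub_add_cancel]
    rw [key]
    refine add_mem (sum_mem fun v _ => G.single_sub_single_mem_range (Quot.out_eq _).symm _) ?_
    rw [AddMonoidHom.mem_ker.1 hg]
    simp [zero_mem]

theorem componentSum_surjective [Fintype V] :
    Function.Surjective (G.componentSum (Q := Q)) := by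
  classical
  intro f
  have := Fintype.ofFinite G.Component
  refine ⟨∑ c : G.Component, Pi.single c.out (f c), ?_⟩
  simp only [map_sum, componentSum_single, Quot.out_eq, Finset.univ_sum_single]

theorem card_flows_mul [Fintype V] [Fintype E] [Finite Q] :
    Nat.card (G.boundaryHom (Q := Q)).ker * Nat.card Q ^ Fintype.card V =
      Nat.card Q ^ (Fintype.card E + G.numComponents Set.univ) := by
  have h1 := (G.boundaryHom (Q := Q)).card_ker_mul_card_range
  have h2 := (G.componentSum (Q := Q)).card_ker_mul_card_range
  rw [AddMonoidHom.range_eq_top.2 G.componentSum_surjective, AddSubgroup.card_top] at h2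
  rw [range_boundaryHom] at h1
  simp only [Nat.card_fun, Nat.card_eq_fintype_card (α := V),
    Nat.card_eq_fintype_card (α := E)] at h1 h2
  rw [← h2, ← mul_assoc, h1, pow_add, numComponents_univ]

theorem numComponents_le [Fintype V] (A : Set E) : G.numComponents A ≤ Fintype.card V := by
  rw [← Nat.card_eq_fintype_card]
  exact Nat.card_le_card_of_surjective (Quot.mk _) Quot.mk_surjective

theorem card_flows [Fintype V] [Fintype E] [Finite Q] [Nontrivial Q] :
    Nat.card (G.boundaryHom (Q := Q)).ker =
      Nat.card Q ^ (Fintype.card E - G.rank Set.univ) := by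
  have h := G.card_flows_mul (Q := Q)
  have hk := G.numComponents_le Set.univ
  have hq : 1 < Nat.card Q := Finite.one_lt_card
  obtain ⟨r, hr⟩ := Nat.exists_eq_add_of_le hk
  have hr' : G.rank Set.univ = r := by rw [rank]; omega
  have h' : Nat.card (G.boundaryHom (Q := Q)).ker * Nat.card Q ^ r =
      Nat.card Q ^ Fintype.card E := by
    rw [hr, pow_add, pow_add, mul_comm (Nat.card Q ^ Fintype.card E), mul_left_comm] at h
    exact Nat.eq_of_mul_eq_mul_left (pow_pos (by omega) _) h
  have hle : r ≤ Fintype.card E := by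
    rw [← Nat.pow_le_pow_iff_right hq, ← h']
    exact Nat.le_mul_of_pos_left _ Nat.card_pos
  rw [hr']
  apply Nat.eq_of_mul_eq_mul_right (pow_pos (by omega : 0 < Nat.card Q) r)
  rw [h', ← pow_add, Nat.sub_add_cancel hle]

/-- The spanning subgraph with edge set `A`. -/
def spanning (A : Finset E) : MGraph V A where
  tail e := G.tail e
  head e := G.head e

theorem rank_spanning [Fintype V] (A : Finset E) :
    (G.spanning A).rank Set.univ = G.rank (A : Set E) := by
  simp [rank, numComponents, spanning, and_left_comm]

theorem boundary_spanning [Fintype E] (A : Finset E) (y : E → Q) (hy : ∀ e ∉ A, y e = 0)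
    (v : V) : (G.spanning A).boundary (fun e : A => y e) v = G.boundary y v := by
  classical
  have key : ∀ p : E → V, (∑ e : {e // e ∈ A} with p e.1 = v, y e.1) =
      ∑ e : E with p e = v, y e := by
    intro p
    rw [Finset.sum_filter, Finset.sum_filter,
      Finset.sum_coe_sort A (fun e => if p e = v then y e else 0)]
    exact Finset.sum_subset (Finset.subset_univ _) fun e _ he => by simp [hy e he]
  exact congrArg₂ (· - ·) (key G.head) (key G.tail)

/-- Extension by zero identifies these with the flows of the spanning subgraph on `A`. -/
theorem card_flows_supported [Fintype V] [Fintype E] [Finite Q] [Nontrivial Q] (A : Finset E) :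
    Nat.card {y : E → Q // (∀ v, G.boundary y v = 0) ∧ ∀ e ∉ A, y e = 0} =
      Nat.card Q ^ (A.card - G.rank (A : Set E)) := by
  classical
  rw [← rank_spanning, ← Fintype.card_coe A, ← card_flows]
  refine Nat.card_congr
    { toFun := fun y => ⟨fun e => y.1 e, ?_⟩
      invFun := fun y => ⟨fun e => if h : e ∈ A then y.1 ⟨e, h⟩ else 0, ?_, ?_⟩
      left_inv := ?_
      right_inv := ?_ }
  · ext v
    exact (G.boundary_spanning A y.1 y.2.2 v).trans (y.2.1 v)
  · intro v
    rw [← boundary_spanning G A _ (fun e he => by simp [he])]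
    simpa [boundaryHom] using congrFun y.2 v
  · intro e he
    simp [he]
  · rintro ⟨y, hy⟩
    ext e
    by_cases he : e ∈ A
    · simp [he]
    · simp [he, hy.2 e he]
  · rintro ⟨y, hy⟩
    ext e
    simp

/-- The value of the flow polynomial at the order of `Q` counts nowhere-zero `Q`-flows. -/
theorem eval_flowPolynomial [Fintype V] [Fintype E] [Finite Q] [Nontrivial Q] :
    G.flowPolynomial.eval (Nat.card Q : ℤ) =
      (Nat.card {y : E → Q // G.IsNowhereZeroFlow y} : ℤ) := by
  classical
  have := Fintype.ofFinite Q
  -- Inclusion–exclusion: expand ∏ (1 - [y e = 0]), with `A` the set of edges at which the term 1 is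
  -- chosen.
  have h1 : ∀ y : E → Q, (∑ A : Finset E, (-1 : ℤ) ^ (Fintype.card E - A.card) *
      if ∀ e ∉ A, y e = 0 then 1 else 0) = if ∀ e, y e ≠ 0 then 1 else 0 := by
    intro y
    have h := Finset.prod_add (fun _ : E => (1 : ℤ)) (fun e => if y e = 0 then -1 else 0)
      Finset.univ
    rw [Finset.powerset_univ] at h
    have hl : ∏ e : E, ((1 : ℤ) + if y e = 0 then -1 else 0) =
        if ∀ e, y e ≠ 0 then 1 else 0 := by
      have : ∀ e : E, ((1 : ℤ) + if y e = 0 then -1 else 0) = if y e ≠ 0 then 1 else 0 := by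
        intro e
        by_cases he : y e = 0 <;> simp [he]
      simp_rw [this, Finset.prod_ite_zero]
      simp
    rw [← hl, h]
    refine Finset.sum_congr rfl fun A _ => ?_
    have : ∀ e : E, (if y e = 0 then (-1 : ℤ) else 0) = -1 * if y e = 0 then 1 else 0 := by
      intro e
      by_cases he : y e = 0 <;> simp [he]
    simp_rw [this, Finset.prod_mul_distrib, Finset.prod_ite_zero]
    simp [Finset.card_sdiff, Finset.card_univ]
  have h2 : ∀ A : Finset E, ((Nat.card Q : ℤ)) ^ (A.card - G.rank (A : Set E)) =
      ∑ y : E → Q, if ∀ v, G.boundary y v = 0 then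
        (if ∀ e ∉ A, y e = 0 then (1 : ℤ) else 0) else 0 := by
    intro A
    rw [← Nat.cast_pow, ← card_flows_supported, Nat.card_eq_fintype_card,
      Fintype.card_subtype]
    simp_rw [← ite_and]
    rw [Finset.sum_boole]
  rw [flowPolynomial, eval_finsetSum]
  simp only [eval_mul, eval_pow, eval_neg, eval_one, eval_X]
  simp_rw [h2, Finset.mul_sum]
  rw [Finset.sum_comm, Nat.card_eq_fintype_card, Fintype.card_subtype, ← Finset.sum_boole]
  refine Finset.sum_congr rfl fun y _ => ?_
  by_cases hb : ∀ v, G.boundary y v = 0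
  · simp only [IsNowhereZeroFlow, hb, implies_true, true_and, if_true, h1]
  · simp [IsNowhereZeroFlow, hb]

end Flows

/-! ### Clockwise coordinates on the half-edges. -/

/-- A labelling of the half-edges of a cubic embedded graph by a vertex and an index modulo `3`
that increases in clockwise order. -/
structure Embedding.Frame {G : MGraph V E} (M : G.Embedding) where
  halfEdge : V × Fin 3 ≃ E × Bool
  vert_halfEdge : ∀ v i, G.vert (halfEdge (v, i)) = v
  rot_halfEdge : ∀ v i, M.rot (halfEdge (v, i)) = halfEdge (v, i + 1)

theorem card_half_edges [Fintype V] [Fintype E] {G : MGraph V E} (hG : G.IsCubic) :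
    Fintype.card V * 3 = Fintype.card E * 2 := by
  have h : Nat.card (E × Bool) = Nat.card (Σ v, {h : E × Bool // G.vert h = v}) :=
    Nat.card_congr (Equiv.sigmaFiberEquiv G.vert).symm
  have h3 : ∀ v, Nat.card {h : E × Bool // G.vert h = v} = 3 := hG
  simp only [Nat.card_sigma, h3, Finset.sum_const, Finset.card_univ, smul_eq_mul,
    Nat.card_eq_fintype_card, Fintype.card_prod, Fintype.card_bool] at h
  exact h.symm

theorem Embedding.exists_frame [Fintype V] [Fintype E] {G : MGraph V E} (M : G.Embedding)
    (hG : G.IsCubic) : Nonempty M.Frame := by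
  classical
  have hb : ∀ v, ∃ h, G.vert h = v := by
    intro v
    have : 0 < Nat.card {h : E × Bool // G.vert h = v} := by
      have := hG v
      rw [degree] at this
      omega
    have := (Nat.card_pos_iff.1 this).1
    exact ⟨this.some.1, this.some.2⟩
  choose b hb using hb
  have hvert : ∀ (k : ℕ) h, G.vert ((M.rot ^ k) h) = G.vert h := by
    intro k
    induction k with
    | zero => simp
    | succ k ih =>
      intro h
      rw [pow_succ', Equiv.Perm.mul_apply, M.vert_rot, ih]
  have hsurj : ∀ h, ∃ i : Fin 3, (M.rot ^ (i : ℕ)) (b (G.vert h)) = h := by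
    intro h
    set x := b (G.vert h) with hx
    have hs : M.rot.SameCycle x h := M.sameCycle _ _ (hb _)
    have hle : (M.rot.cycleOf x).support.card ≤ 3 := by
      rw [← hG (G.vert h), degree, Nat.card_eq_fintype_card, Fintype.card_subtype]
      apply Finset.card_le_card
      intro z hz
      have hz' := (Equiv.Perm.mem_support_cycleOf_iff.1 hz).1
      obtain ⟨k, hk⟩ := hz'.exists_nat_pow_eq
      rw [Finset.mem_filter]
      exact ⟨Finset.mem_univ _, by rw [← hk, hvert, hb]⟩
    -- A support omits fixed points, so a cycle of length one needs its own case.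
    by_cases hfix : M.rot x = x
    · refine ⟨0, ?_⟩
      obtain ⟨k, hk⟩ := hs.exists_nat_pow_eq
      have : (M.rot ^ k) x = x := Function.IsFixedPt.perm_pow hfix k
      rw [this] at hk
      simpa using hk
    · obtain ⟨k, hk, hk'⟩ := hs.exists_pow_eq_of_mem_support (Equiv.Perm.mem_support.2 hfix)
      exact ⟨⟨k, by omega⟩, hk'⟩
  let T : V × Fin 3 → E × Bool := fun p => (M.rot ^ (p.2 : ℕ)) (b p.1)
  have hTv : ∀ v i, G.vert (T (v, i)) = v := fun v i => by rw [hvert, hb]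
  have hTs : Function.Surjective T := fun h => by
    obtain ⟨i, hi⟩ := hsurj h
    exact ⟨(G.vert h, i), hi⟩
  have hTb : Function.Bijective T := by
    rw [Fintype.bijective_iff_surjective_and_card]
    refine ⟨hTs, ?_⟩
    simpa using card_half_edges hG
  refine ⟨⟨Equiv.ofBijective T hTb, hTv, ?_⟩⟩
  intro v i
  have hsucc : ∀ i j : Fin 3, (j : ℕ) = i + 1 → M.rot (T (v, i)) = T (v, j) := by
    intro i j hij
    simp only [T]
    rw [hij, pow_succ', Equiv.Perm.mul_apply]
  -- The successor stays at `v`; indices 1 and 2 already have predecessors 0 and 1, so injectivity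
  -- of `rot` leaves only 0.
  have hwrap : M.rot (T (v, 2)) = T (v, 0) := by
    obtain ⟨⟨w, j⟩, hj⟩ := hTs (M.rot (T (v, 2)))
    have hw : w = v := by rw [← hTv w j, hj, M.vert_rot, hTv]
    subst hw
    fin_cases j
    · exact hj.symm
    · have h := hTb.1 (M.rot.injective (hj.symm.trans (hsucc 0 1 rfl).symm))
      simp at h
    · have h := hTb.1 (M.rot.injective (hj.symm.trans (hsucc 1 2 rfl).symm))
      simp at h
  fin_cases i
  · exact hsucc 0 1 rfl
  · exact hsucc 1 2 rfl
  · exact hwrap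

namespace Embedding.Frame

variable {G : MGraph V E} {M : G.Embedding} (T : M.Frame)

/-- The values of a function on the edges at the three half-edges of a vertex. -/
def around {α : Type*} (y : E → α) (v : V) (i : Fin 3) : α :=
  y (T.halfEdge (v, i)).1

theorem exists_halfEdge (h : E × Bool) : ∃ i, T.halfEdge (G.vert h, i) = h := by
  obtain ⟨⟨v, i⟩, rfl⟩ := T.halfEdge.surjective h
  exact ⟨i, by rw [T.vert_halfEdge]⟩

theorem sum_halfEdge [Fintype V] [Fintype E] {A : Type*} [AddCommMonoid A] (g : E × Bool → A) :
    ∑ v, ∑ i, g (T.halfEdge (v, i)) = ∑ e, (g (e, false) + g (e, true)) := by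
  rw [← Fintype.sum_prod_type (fun p => g (T.halfEdge p)), Equiv.sum_comp T.halfEdge g,
    Fintype.sum_prod_type]
  simp [add_comm]

theorem prod_halfEdge [Fintype V] [Fintype E] {A : Type*} [CommMonoid A] (g : E × Bool → A) :
    ∏ v, ∏ i, g (T.halfEdge (v, i)) = ∏ e, g (e, false) * g (e, true) := by
  rw [← Fintype.prod_prod_type (fun p => g (T.halfEdge p)), Equiv.prod_comp T.halfEdge g,
    Fintype.prod_prod_type]
  simp [mul_comm]

/-- In exponent 2 signs vanish, so the orientation of the edges is irrelevant. -/
theorem boundary_eq_sum_around [Fintype V] [Fintype E] {Q : Type*} [AddCommGroup Q]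
    (hQ : ∀ q : Q, q + q = 0) (y : E → Q) (v : V) : G.boundary y v = ∑ i, T.around y v i := by
  classical
  have h := T.sum_halfEdge (fun h => if G.vert h = v then y h.1 else 0)
  simp only [T.vert_halfEdge] at h
  rw [Finset.sum_eq_single v (fun w _ hw => by simp [hw]) (by simp)] at h
  simp only [if_true] at h
  have hneg : ∀ q : Q, -q = q := fun q => neg_eq_of_add_eq_zero_left (hQ q)
  rw [boundary, sub_eq_add_neg, hneg, Finset.sum_filter, Finset.sum_filter, add_comm,
    ← Finset.sum_add_distrib]
  exact h.symm

end Embedding.Frame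

/-! ### Face functions -/

namespace Embedding

variable {G : MGraph V E} (M : G.Embedding)

/-- The set of faces of the embedding. -/
abbrev Face : Type _ := Quotient (Equiv.Perm.SameCycle.setoid M.face)

/-- The face at a half-edge. -/
abbrev faceOf (h : E × Bool) : M.Face := Quotient.mk _ h

theorem faceOf_flip (h : E × Bool) : M.faceOf (flip E h) = M.faceOf (M.rot h) := by
  apply Quotient.sound
  have hface : M.face (flip E h) = M.rot h := by
    rcases h with ⟨e, b⟩
    cases b <;> rfl
  rw [← hface]
  exact Equiv.Perm.sameCycle_apply_right.2 (Equiv.Perm.SameCycle.refl _ _)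

/-- The coboundary of a face function, modulo `2`. -/
def faceDiff : (M.Face → ZMod 2) →+ (E → ZMod 2) where
  toFun f e := f (M.faceOf (e, false)) + f (M.faceOf (e, true))
  map_zero' := by ext; simp
  map_add' f g := by
    ext e
    simp only [Pi.add_apply]
    abel

theorem faceDiff_apply (f : M.Face → ZMod 2) (h : E × Bool) :
    M.faceDiff f h.1 = f (M.faceOf h) + f (M.faceOf (M.rot h)) := by
  rw [← faceOf_flip]
  rcases h with ⟨e, b⟩
  cases b
  · rfl
  · exact add_comm _ _

theorem range_faceDiff_le [Fintype V] [Fintype E] (T : M.Frame) :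
    M.faceDiff.range ≤ (G.boundaryHom (Q := ZMod 2)).ker := by
  rintro _ ⟨f, rfl⟩
  ext v
  change G.boundary _ v = 0
  rw [T.boundary_eq_sum_around CharTwo.add_self_eq_zero]
  simp only [Frame.around, faceDiff_apply, T.rot_halfEdge, Fin.sum_univ_three]
  have key : ∀ a b c : ZMod 2, a + b + (b + c) + (c + a) = 0 := by decide
  exact key _ _ _

/-- A function in the kernel does not change across any edge, so it is constant around each vertex
and hence on each component. -/
theorem card_ker_faceDiff_le [Fintype V] (T : M.Frame) :
    Nat.card M.faceDiff.ker ≤ 2 ^ G.numComponents Set.univ := by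
  have hex : ∀ f : M.faceDiff.ker, ∃ g : G.Component → ZMod 2,
      ∀ h, f.1 (M.faceOf h) = g (Quot.mk _ (G.vert h)) := by
    rintro ⟨f, hf⟩
    have hrot : ∀ h, f (M.faceOf h) = f (M.faceOf (M.rot h)) := by
      intro h
      have := congrFun hf h.1
      rw [faceDiff_apply] at this
      exact CharTwo.add_eq_zero.1 this
    have h0 : ∀ h, f (M.faceOf h) = f (M.faceOf (T.halfEdge (G.vert h, 0))) := by
      intro h
      obtain ⟨i, hi⟩ := T.exists_halfEdge h
      have h1 := hrot (T.halfEdge (G.vert h, 0))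
      have h2 := hrot (T.halfEdge (G.vert h, 1))
      rw [T.rot_halfEdge] at h1 h2
      rw [← hi, T.vert_halfEdge]
      fin_cases i
      · rfl
      · exact h1.symm
      · exact (h1.trans h2).symm
    refine ⟨Quot.lift (fun v => f (M.faceOf (T.halfEdge (v, 0)))) ?_, h0⟩
    rintro _ _ ⟨e, rfl, rfl⟩
    have h1 := h0 (e, false)
    have h2 := h0 (e, true)
    have h3 := hrot (e, false)
    rw [← faceOf_flip] at h3
    exact h1.symm.trans (h3.trans h2)
  choose g hg using hex
  have hinj : Function.Injective g := by
    intro f f' hff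
    apply Subtype.ext
    ext c
    obtain ⟨h, rfl⟩ := Quotient.exists_rep c
    exact (hg f h).trans (hff ▸ (hg f' h).symm)
  refine (Nat.card_le_card_of_injective g hinj).trans ?_
  rw [Nat.card_fun, Nat.card_zmod, numComponents_univ]

/-- In a plane embedding, all cycles modulo `2` are coboundaries of face functions. -/
theorem range_faceDiff [Fintype V] [Fintype E] (T : M.Frame) (hM : M.IsPlane) :
    M.faceDiff.range = (G.boundaryHom (Q := ZMod 2)).ker := by
  refine AddSubgroup.eq_of_le_of_card_ge (M.range_faceDiff_le T) ?_
  have h1 := M.faceDiff.card_ker_mul_card_range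
  have h2 := M.card_ker_faceDiff_le T
  have h3 := G.card_flows_mul (Q := ZMod 2)
  rw [Nat.card_fun, Nat.card_zmod] at h1
  rw [Nat.card_zmod] at h3
  have h4 : Fintype.card V + M.numFaces =
      Fintype.card E + G.numComponents Set.univ + G.numComponents Set.univ := by
    rw [IsPlane] at hM
    omega
  -- This factor clears denominators, so that Euler's formula compares exponents without
  -- subtraction.
  refine Nat.le_of_mul_le_mul_right ?_
    (by positivity : 0 < 2 ^ Fintype.card V * 2 ^ G.numComponents Set.univ)
  rw [← mul_assoc, h3, ← pow_add, ← h4, pow_add, mul_left_comm]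
  refine Nat.mul_le_mul_left _ ?_
  rw [numFaces, ← h1, mul_comm]
  exact Nat.mul_le_mul_left _ h2

end Embedding

/-! ### Finite identities at a single vertex. -/

/-- The Levi-Civita symbol. -/
def leviCivita (l : Fin 3 → Fin 3) : ℤ :=
  if l 0 = l 1 ∨ l 1 = l 2 ∨ l 0 = l 2 then 0 else if l 1 = l 0 + 1 then 1 else -1

/-- The constant function `1` and the functions `cos` and `sin` on the multiples of `π / 2`. -/
def trig : Fin 3 → Fin 4 → ℤ :=
  ![![1, 1, 1, 1], ![1, 0, -1, 0], ![0, 1, 0, -1]]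

/-- The squared norms of the functions `trig`. -/
def trigNorm : Fin 3 → ℤ := ![4, 2, 2]

/-- The sign of three colours read clockwise: `0` if they are not distinct, `-1` if they are in
anticlockwise order. -/
def colourSign (a : Fin 3 → Fin 4) : ℤ :=
  if a 0 = a 1 ∨ a 1 = a 2 ∨ a 0 = a 2 then 0
  else if a 2 < a 1 ∧ a 1 < a 0 ∨ a 1 < a 0 ∧ a 0 < a 2 ∨ a 0 < a 2 ∧ a 2 < a 1 then -1 else 1

theorem trig_orthogonal (i j : Fin 3) :
    ∑ a, trig i a * trig j a = if i = j then trigNorm i else 0 := by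
  decide +revert

/-- The right side is a determinant: twice the signed area of the triangle formed by three corners
of a square inscribed in the unit circle. -/
theorem two_mul_colourSign (a : Fin 3 → Fin 4) :
    2 * colourSign a = ∑ l, leviCivita l * ∏ i, trig (l i) (a i) := by
  revert a
  decide +kernel

theorem colourSign_eq_zero (a : Fin 3 → Fin 4) : colourSign a = 0 ↔ ¬ Function.Injective a := by
  decide +kernel +revert

theorem colourSign_of_anticlockwise (a : Fin 3 → Fin 4)
    (h : ∃ i, sbtw (a (i + 1 + 1)) (a (i + 1)) (a i)) : colourSign a = -1 := by
  simp only [Fin.sbtw_iff] at h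
  decide +kernel +revert

theorem colourSign_of_clockwise (a : Fin 3 → Fin 4) (ha : Function.Injective a)
    (h : ¬ ∃ i, sbtw (a (i + 1 + 1)) (a (i + 1)) (a i)) : colourSign a = 1 := by
  simp only [Fin.sbtw_iff] at h
  decide +kernel +revert

theorem prod_trigNorm (l : Fin 3 → Fin 3) (hl : leviCivita l ≠ 0) : ∏ i, trigNorm (l i) = 16 := by
  decide +kernel +revert

theorem sum_leviCivita_ne_zero (l : Fin 3 → Fin 3) (hl : leviCivita l ≠ 0) :
    ∑ i, (if l i = 0 then 1 else 0) = 1 := by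
  decide +kernel +revert

/-- The non-zero elements of the Klein four-group. -/
def klein : Fin 3 → ZMod 2 × ZMod 2 := ![(1, 0), (0, 1), (1, 1)]

theorem klein_injective : Function.Injective klein := by decide

theorem klein_ne_zero (i : Fin 3) : klein i ≠ 0 := by decide +revert

theorem exists_klein (q : ZMod 2 × ZMod 2) (hq : q ≠ 0) : ∃ i, klein i = q := by decide +revert

theorem sum_klein (l : Fin 3 → Fin 3) : ∑ i, klein (l i) = 0 ↔ leviCivita l ≠ 0 := by
  decide +kernel +revert

/-- The indicator function of the colours `0` and `1`. -/
def isLow : Fin 3 → ZMod 2 := ![1, 1, 0]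

theorem sum_isLow (l : Fin 3 → Fin 3) (hl : leviCivita l ≠ 0) : ∑ i, isLow (l i) = 0 := by
  decide +kernel +revert

/-- Here `a` gives the values of the faces around the vertex. The half-edge of colour 2 has one
value t on both sides, and the third face has t + 1. Leaving out colour 1, the remaining two values
agree or differ according to the cyclic order of the colours. -/
theorem leviCivita_eq_pow (l : Fin 3 → Fin 3) (hl : leviCivita l ≠ 0) (a : Fin 3 → ZMod 2)
    (ha : ∀ i, isLow (l i) = a i + a (i + 1)) :
    leviCivita l = (-1) ^ (∑ i, if l i = 1 then 0 else a i).val := by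
  decide +kernel +revert
namespace Embedding.Frame
variable {G : MGraph V E} {M : G.Embedding} (T : M.Frame)

/-! ### Edge `4`-colourings -/

theorem isProperEdgeColouring_iff (y : E → Fin 4) :
    G.IsProperEdgeColouring y ↔ ∀ v, Function.Injective (T.around y v) := by
  constructor
  · intro h v i j hij
    by_contra hne
    refine h (T.halfEdge (v, i)) (T.halfEdge (v, j)) ?_ ?_ hij
    · intro heq
      simpa [hne] using T.halfEdge.injective heq
    · rw [T.vert_halfEdge, T.vert_halfEdge]
  · intro h h₁ h₂ hne hv heq
    obtain ⟨i, hi⟩ := T.exists_halfEdge h₁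
    obtain ⟨j, hj⟩ := T.exists_halfEdge h₂
    rw [← hv] at hj
    have hij : i = j := h (G.vert h₁) (by simp only [around]; rw [hi, hj, heq])
    exact hne (by rw [← hi, ← hj, hij])

theorem isAnticlockwiseAt_iff (y : E → Fin 4) (v : V) :
    M.IsAnticlockwiseAt y v ↔
      ∃ i, sbtw (T.around y v (i + 1 + 1)) (T.around y v (i + 1)) (T.around y v i) := by
  constructor
  · rintro ⟨h, rfl, hs⟩
    obtain ⟨i, hi⟩ := T.exists_halfEdge h
    refine ⟨i, ?_⟩
    simp only [around, ← T.rot_halfEdge, hi]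
    exact hs
  · rintro ⟨i, hi⟩
    refine ⟨T.halfEdge (v, i), T.vert_halfEdge v i, ?_⟩
    simpa only [around, ← T.rot_halfEdge] using hi

theorem prod_colourSign [Fintype V] (y : E → Fin 4) (hy : G.IsProperEdgeColouring y) :
    ∏ v, colourSign (T.around y v) = (-1) ^ M.numAnticlockwise y := by
  classical
  have h : ∀ v, colourSign (T.around y v) = if M.IsAnticlockwiseAt y v then -1 else 1 := by
    intro v
    rw [T.isAnticlockwiseAt_iff]
    split_ifs with hv
    · exact colourSign_of_anticlockwise _ hv
    · exact colourSign_of_clockwise _ ((T.isProperEdgeColouring_iff y).1 hy v) hv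
  simp_rw [h]
  rw [Finset.prod_ite, Finset.prod_const, Finset.prod_const_one, mul_one, numAnticlockwise,
    Nat.card_eq_fintype_card, Fintype.card_subtype]

variable [Fintype V] [Fintype E]

theorem numEven_sub_numOdd [DecidableEq E] :
    (M.numEven : ℤ) - M.numOdd = ∑ y : E → Fin 4, ∏ v, colourSign (T.around y v) := by
  classical
  rw [numEven, numOdd, Nat.card_eq_fintype_card, Nat.card_eq_fintype_card,
    Fintype.card_subtype, Fintype.card_subtype, ← Finset.sum_boole, ← Finset.sum_boole,
    ← Finset.sum_sub_distrib]
  refine Finset.sum_congr rfl fun y _ => ?_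
  by_cases hy : G.IsProperEdgeColouring y
  · rw [T.prod_colourSign y hy]
    rcases Nat.even_or_odd (M.numAnticlockwise y) with h | h
    · simp [hy, h, h.neg_one_pow]
    · simp [hy, h, h.neg_one_pow]
  · obtain ⟨v, hv⟩ := not_forall.1 (mt (T.isProperEdgeColouring_iff y).2 hy)
    rw [Finset.prod_eq_zero (Finset.mem_univ v) ((colourSign_eq_zero _).2 hv)]
    simp [hy]

theorem two_pow_mul_sum_colourSign [DecidableEq E] :
    2 ^ Fintype.card V * ∑ y : E → Fin 4, ∏ v, colourSign (T.around y v) =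
      ∑ c : E → Fin 3, (∏ v, leviCivita (T.around c v)) * ∏ e, trigNorm (c e) := by
  classical
  have h1 : ∀ y : E → Fin 4, 2 ^ Fintype.card V * ∏ v, colourSign (T.around y v) =
      ∑ p : V → Fin 3 → Fin 3, (∏ v, leviCivita (p v)) *
        ∏ v, ∏ i, trig (p v i) (T.around y v i) := by
    intro y
    rw [← Finset.card_univ, ← Finset.prod_const, ← Finset.prod_mul_distrib]
    simp_rw [two_mul_colourSign, Fintype.prod_sum, Finset.prod_mul_distrib]
  have h2 : ∀ p : V → Fin 3 → Fin 3,
      ∑ y : E → Fin 4, ∏ v, ∏ i, trig (p v i) (T.around y v i) =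
      ∏ e, if Function.uncurry p (T.halfEdge.symm (e, false)) =
          Function.uncurry p (T.halfEdge.symm (e, true)) then
        trigNorm (Function.uncurry p (T.halfEdge.symm (e, false))) else 0 := by
    intro p
    simp_rw [← trig_orthogonal, Fintype.prod_sum]
    refine Finset.sum_congr rfl fun y _ => ?_
    rw [← T.prod_halfEdge (fun h => trig (Function.uncurry p (T.halfEdge.symm h)) (y h.1))]
    simp [around]
  rw [Finset.mul_sum]
  simp_rw [h1]
  rw [Finset.sum_comm]
  simp_rw [← Finset.mul_sum, h2]
  symm
  -- Labellings agreeing across every edge are those induced by edge colourings; all others have a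
  -- vanishing factor in `h2`.
  refine Finset.sum_of_injOn (fun c => T.around c) ?_
    (fun _ _ => Finset.mem_coe.2 (Finset.mem_univ _)) ?_ ?_
  · intro c _ c' _ hcc
    ext1 e
    have := congrFun (congrFun hcc (T.halfEdge.symm (e, false)).1) (T.halfEdge.symm (e, false)).2
    simpa [around] using this
  · intro p _ hp
    rw [mul_eq_zero]
    right
    by_contra hne
    replace hne := Finset.prod_ne_zero_iff.1 hne
    apply hp
    refine ⟨fun e => Function.uncurry p (T.halfEdge.symm (e, false)), by simp, ?_⟩
    have hboth : ∀ h : E × Bool, Function.uncurry p (T.halfEdge.symm (h.1, false)) =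
        Function.uncurry p (T.halfEdge.symm h) := by
      rintro ⟨e, b⟩
      have := hne e (Finset.mem_univ e)
      cases b
      · rfl
      · by_contra h
        simp [h] at this
    ext v i : 2
    simp [around, hboth]
  · intro c _
    congr 1
    refine Finset.prod_congr rfl fun e _ => ?_
    have hc : ∀ h, Function.uncurry (T.around c) (T.halfEdge.symm h) = c h.1 := by
      intro h
      simp [around, Function.uncurry]
    simp [hc]

/-! ### Edge `3`-colourings -/

/-- A proper edge `3`-colouring. -/
def IsTait (c : E → Fin 3) : Prop := ∀ v, leviCivita (T.around c v) ≠ 0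

/-- Three nonzero elements of the Klein group sum to zero exactly when they are distinct. -/
theorem card_isTait : Nat.card {c : E → Fin 3 // T.IsTait c} =
    Nat.card {y : E → ZMod 2 × ZMod 2 // G.IsNowhereZeroFlow y} := by
  have key : ∀ c : E → Fin 3, G.IsNowhereZeroFlow (klein ∘ c) ↔ T.IsTait c := by
    intro c
    simp only [IsNowhereZeroFlow, Function.comp_apply, ne_eq, klein_ne_zero, not_false_eq_true,
      implies_true, and_true, IsTait]
    refine forall_congr' fun v => ?_
    rw [T.boundary_eq_sum_around CharTwo.add_self_eq_zero]
    exact sum_klein _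
  refine Nat.card_eq_of_bijective (fun c => ⟨klein ∘ c.1, (key c.1).2 c.2⟩) ⟨?_, ?_⟩
  · intro c c' h
    exact Subtype.ext (klein_injective.comp_left (congrArg Subtype.val h))
  · rintro ⟨y, hy⟩
    choose c hc using fun e => exists_klein (y e) (hy.2 e)
    obtain rfl : klein ∘ c = y := funext hc
    exact ⟨⟨c, (key c).1 hy⟩, rfl⟩

variable {T} {c : E → Fin 3}

/-- Every vertex sees norms 4, 2, 2 and every edge is seen twice, so the square is 16^(2n);
nonnegativity selects the root. -/
theorem IsTait.prod_trigNorm (hc : T.IsTait c) {n : ℕ} (hn : Fintype.card V = 2 * n) :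
    ∏ e, trigNorm (c e) = 16 ^ n := by
  have h := T.prod_halfEdge (fun h => trigNorm (c h.1))
  have h16 : ∀ v, ∏ i, trigNorm (c (T.halfEdge (v, i)).1) = 16 :=
    fun v => MGraph.prod_trigNorm _ (hc v)
  simp only [h16, Finset.prod_const, Finset.card_univ, Finset.prod_mul_distrib, hn] at h
  have hpos : 0 ≤ ∏ e, trigNorm (c e) := Finset.prod_nonneg fun e _ => by
    generalize c e = i
    decide +revert
  rw [← sq_eq_sq₀ hpos (by positivity), sq, ← h, ← pow_mul, mul_comm]

theorem IsTait.card_colour_zero (hc : T.IsTait c) {n : ℕ} (hn : Fintype.card V = 2 * n) :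
    ∑ e, (if c e = 0 then 1 else 0) = n := by
  have h := T.sum_halfEdge (fun h => if c h.1 = 0 then 1 else 0)
  have h1 : ∀ v, ∑ i, (if c (T.halfEdge (v, i)).1 = 0 then 1 else 0) = 1 :=
    fun v => sum_leviCivita_ne_zero _ (hc v)
  simp only [h1, Finset.sum_const, Finset.card_univ, Finset.sum_add_distrib, hn,
    smul_eq_mul] at h
  omega

theorem neg_one_pow_val_sum {ι : Type*} (s : Finset ι) (f : ι → ZMod 2) :
    ∏ i ∈ s, (-1 : ℤ) ^ (f i).val = (-1) ^ (∑ i ∈ s, f i).val := by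
  classical
  have hadd : ∀ a b : ZMod 2, (-1 : ℤ) ^ (a + b).val = (-1) ^ a.val * (-1) ^ b.val := by decide
  induction s using Finset.induction_on with
  | empty => simp
  | insert a s ha ih => rw [Finset.prod_insert ha, Finset.sum_insert ha, hadd, ih]

/-- In a plane cubic graph with `2 * n` vertices, the product of the vertex signs of an edge
`3`-colouring is `(-1) ^ n`. -/
theorem IsTait.prod_leviCivita (hc : T.IsTait c) (hM : M.IsPlane) {n : ℕ}
    (hn : Fintype.card V = 2 * n) : ∏ v, leviCivita (T.around c v) = (-1) ^ n := by
  have hcycle : isLow ∘ c ∈ (G.boundaryHom (Q := ZMod 2)).ker := by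
    ext v
    change G.boundary _ v = 0
    rw [T.boundary_eq_sum_around CharTwo.add_self_eq_zero]
    exact sum_isLow _ (hc v)
  rw [← M.range_faceDiff T hM] at hcycle
  obtain ⟨f, hf⟩ := hcycle
  have hsign : ∀ v, leviCivita (T.around c v) = (-1) ^ (∑ i,
      if c (T.halfEdge (v, i)).1 = 1 then 0 else f (M.faceOf (T.halfEdge (v, i)))).val := by
    intro v
    refine leviCivita_eq_pow _ (hc v) (fun i => f (M.faceOf (T.halfEdge (v, i)))) fun i => ?_
    rw [← T.rot_halfEdge, ← M.faceDiff_apply, hf]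
    rfl
  simp_rw [hsign]
  rw [neg_one_pow_val_sum,
    T.sum_halfEdge (fun h => if c h.1 = 1 then 0 else f (M.faceOf h))]
  -- The two sides of an edge have different values for colour 0 and equal ones for colour 2, while
  -- colour 1 is left out; the total thus counts the edges of colour 0.
  have hedge : ∀ e, ((if c e = 1 then 0 else f (M.faceOf (e, false))) +
      if c e = 1 then 0 else f (M.faceOf (e, true))) =
        ((if c e = 0 then 1 else 0 : ℕ) : ZMod 2) := by
    intro e
    have h : f (M.faceOf (e, false)) + f (M.faceOf (e, true)) = isLow (c e) := congrFun hf e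
    generalize c e = i at *
    fin_cases i
    · exact h
    · rfl
    · exact h
  simp only [hedge]
  rw [← Nat.cast_sum, hc.card_colour_zero hn, ZMod.val_natCast, ← neg_one_pow_eq_pow_mod_two]

end Embedding.Frame
end MGraph

/-! ### Assembly of the two counts. -/

theorem proposition1p3 {V E : Type*} [Fintype V] [Fintype E] (G : MGraph V E)
    (hG : G.IsCubic) (M : G.Embedding) (hM : M.IsPlane) :
    3 ∣ Fintype.card E ∧
    (∀ (Q : Type*) [AddCommGroup Q], Nat.card Q = 4 →
      G.flowPolynomial.eval 4 = (Nat.card {y : E → Q // G.IsNowhereZeroFlow y} : ℤ)) ∧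
    (-4 : ℤ) ^ (Fintype.card E / 3) * G.flowPolynomial.eval 4 =
      (M.numEven : ℤ) - (M.numOdd : ℤ) := by
  classical
  have hcard := MGraph.card_half_edges hG
  obtain ⟨n, hE⟩ : ∃ n, Fintype.card E = 3 * n := ⟨Fintype.card E / 3, by omega⟩
  have hV : Fintype.card V = 2 * n := by omega
  refine ⟨⟨n, hE⟩, fun Q _ hQ => ?_, ?_⟩
  · have : Finite Q := Nat.finite_of_card_ne_zero (by omega)
    have : Nontrivial Q := Finite.one_lt_card_iff_nontrivial.1 (by omega)
    simpa [hQ] using G.eval_flowPolynomial (Q := Q)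
  · obtain ⟨T⟩ := M.exists_frame hG
    have hflow := G.eval_flowPolynomial (Q := ZMod 2 × ZMod 2)
    rw [← T.card_isTait, Nat.card_prod, Nat.card_zmod] at hflow
    have hterm : ∀ c : E → Fin 3,
        (∏ v, MGraph.leviCivita (T.around c v)) * ∏ e, MGraph.trigNorm (c e) =
          (-16) ^ n * if T.IsTait c then 1 else 0 := by
      intro c
      by_cases hc : T.IsTait c
      · rw [hc.prod_leviCivita hM hV, hc.prod_trigNorm hV, ← mul_pow]
        simp [hc]
      · obtain ⟨v, hv⟩ := not_forall.1 hc
        rw [Finset.prod_eq_zero (Finset.mem_univ v) (not_not.1 hv)]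
        simp [hc]
    have hsum := T.two_pow_mul_sum_colourSign
    rw [← T.numEven_sub_numOdd] at hsum
    simp_rw [hterm] at hsum
    rw [← Finset.mul_sum, Finset.sum_boole, ← Fintype.card_subtype,
      ← Nat.card_eq_fintype_card (α := {c // T.IsTait c}), hV, pow_mul] at hsum
    have h16 : (-16 : ℤ) ^ n = (2 ^ 2) ^ n * (-4) ^ n := by
      rw [← mul_pow]
      norm_num
    rw [h16, mul_assoc] at hsum
    have h4 : ((2 * 2 : ℕ) : ℤ) = 4 := by norm_num
    rw [h4] at hflow
    rw [hE, Nat.mul_div_cancel_left n (by norm_num), hflow]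
    exact (mul_left_cancel₀ (by positivity) hsum).symm
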